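/- Let $\mathbb R_+=(0,\infty)$, and let $M_+(\mathbb R_+)$ and $M_+(\mathbb R_+^2)$ denote the classes of nonnegative (possibly infinite-valued) Lebesgue-measurable functions on $\mathbb R_+$ and $\mathbb R_+^2$. Fix $K\in M_+(\mathbb R_+^2)$. For $i=1,2$ let $\Phi_i(x)=\int_0^x\phi_i(y)\,dy$ be an $N$-function, where $\phi_i$ is a nondecreasing function mapping $\mathbb R_+$ onto itself, and let $\Psi_i(t)=\int_0^t\phi_i^{-1}(s)\,ds$ be its complementary function, where $\phi_i^{-1}(s)=\inf\{x>0:\phi_i(x)\ge s\}$. Assume that $\Phi_2(2t)\approx\Phi_2(t)$ for $t\gg1$. Let $u_1,u_2$ be weights, that is, nonnegative locally integrable functions on $\mathbb R_+$, with $\int_{\mathbb R_+}u_2=\infty$, and put $U_2(x)=\int_0^xu_2(z)\,dz$. For a function $\Phi$ and a weight $u$ let $$\rho_{\Phi,u}(f)=\inf\Big\{\lambda>0:\int_{\mathbb R_+}\Phi\Big(\frac{f(x)}{\lambda}\Big)u(x)\,dx\le1\Big\},\qquad f\in M_+(\mathbb R_+),$$ let $f^*(t)=\inf\{\lambda\ge0:|\{x\in\mathbb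 R_+:f(x)>\lambda\}|\le t\}$ be the nonincreasing rearrangement of $f$, and let $$(T_Kf)(x)=\int_{\mathbb R_+}K(x,y)f(y)\,dy,\qquad (Sg)(x)=\int_0^x\Big(\int_{\mathbb R_+}K(z,y)g(z)\,dz\Big)dy .$$ If there is a constant $C>0$ such that $$\rho_{\Psi_2,u_2}\big(Sg/U_2\big)\le C\,\rho_{\Psi_1,u_1}\big(g/u_1\big)$$ for all $g\in M_+(\mathbb R_+)$ (where only those $g$ that vanish wherever $u_1$ vanishes need be considered, the right-hand side being understood as $\infty$ otherwise, and $0/0=0$), then there is a constant $C'>0$ such that $$\rho_{\Phi_1,u_1}(T_Kf^*)\le C'\,\rho_{\Phi_2,u_2}(f^*)\qquad\text{for all } f\in M_+(\mathbb R_+).$$ -/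

import Mathlib

open MeasureTheory Set
open scoped ENNReal NNReal

noncomputable section

namespace OrliczLorentz

/-- Membership in `M₊(ℝ₊)`, `ℝ₊ = (0, ∞)`: `f` is nonnegative (values in `[0, ∞]`) and Lebesgue
measurable on `(0, ∞)`.  Values of `f` outside `(0, ∞)` play no role anywhere below. -/
def MPlus (f : ℝ → ℝ≥0∞) : Prop :=
  AEMeasurable f (volume.restrict (Ioi (0 : ℝ)))

/-- Membership in `M₊(ℝ₊²)`. -/
def MPlus₂ (K : ℝ → ℝ → ℝ≥0∞) : Prop :=
  AEMeasurable (Function.uncurry K) (volume.restrict (Ioi (0 : ℝ) ×ˢ Ioi (0 : ℝ)))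

/-- A weight on `ℝ₊ = (0, ∞)`: a nonnegative locally integrable function. -/
structure IsWeight (u : ℝ → ℝ) : Prop where
  nonneg : ∀ x, 0 < x → 0 ≤ u x
  locallyIntegrable : LocallyIntegrableOn u (Ioi (0 : ℝ)) volume

/-- `x ↦ ∫₀ˣ φ(y) dy` as a function of `x ∈ [0, ∞]`. -/
def primitive (φ : ℝ → ℝ) (x : ℝ≥0∞) : ℝ≥0∞ :=
  ∫⁻ y in {y : ℝ | 0 < y ∧ ENNReal.ofReal y < x}, ENNReal.ofReal (φ y)

/-- An `N`-function `Φ(x) = ∫₀ˣ φ`, given by its density `φ`, a nondecreasing function mapping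
`ℝ₊ = (0, ∞)` onto itself. -/
structure NFunction where
  /-- the density -/
  φ : ℝ → ℝ
  monotoneOn : MonotoneOn φ (Ioi 0)
  image_eq : φ '' Ioi 0 = Ioi 0

/-- The value `Φ(x) = ∫₀ˣ φ`, for `x ∈ [0, ∞]`. -/
def NFunction.val (Φ : NFunction) : ℝ≥0∞ → ℝ≥0∞ := primitive Φ.φ

/-- The (generalized) inverse `φ⁻¹(s) = inf {x > 0 : s ≤ φ(x)}`, `s > 0`, of the density. -/
def NFunction.invDensity (Φ : NFunction) (s : ℝ) : ℝ := sInf {x : ℝ | 0 < x ∧ s ≤ Φ.φ x}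

/-- The complementary function `Ψ(t) = ∫₀ᵗ φ⁻¹`, for `t ∈ [0, ∞]`. -/
def NFunction.compl (Φ : NFunction) : ℝ≥0∞ → ℝ≥0∞ := primitive Φ.invDensity

/-- `Φ(2t) ≈ Φ(t)` for `t ≫ 1` (the estimate `Φ(t) ≤ Φ(2t)` always holds). -/
def NFunction.DoublingAtInfinity (Φ : NFunction) : Prop :=
  ∃ (D t₀ : ℝ≥0), ∀ t : ℝ≥0, t₀ ≤ t → Φ.val (2 * t) ≤ D * Φ.val t

/-- The gauge norm
`ρ_{Φ,u}(f) = inf {l > 0 : ∫_{ℝ₊} Φ(f(x)/l) u(x) dx ≤ 1}` in `[0, ∞]`. -/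
def gauge (Φ : ℝ≥0∞ → ℝ≥0∞) (u : ℝ → ℝ) (f : ℝ → ℝ≥0∞) : ℝ≥0∞ :=
  sInf {l : ℝ≥0∞ | 0 < l ∧ l < ⊤ ∧
    ∫⁻ x in Ioi (0 : ℝ), Φ (f x / l) * ENNReal.ofReal (u x) ≤ 1}

/-- The distribution function `μ_f(l) = |{x ∈ ℝ₊ : f(x) > l}|`. -/
def distrib (f : ℝ → ℝ≥0∞) (l : ℝ≥0∞) : ℝ≥0∞ :=
  volume {x : ℝ | 0 < x ∧ l < f x}

/-- The nonincreasing rearrangement `f* = μ_f⁻¹` of `f` on `ℝ₊`, that is,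
`f*(t) = inf {l ≥ 0 : μ_f(l) ≤ t}`. -/
def rearrangement (f : ℝ → ℝ≥0∞) (t : ℝ) : ℝ≥0∞ :=
  sInf {l : ℝ≥0∞ | distrib f l ≤ ENNReal.ofReal t}

/-- `(T_K f)(x) = ∫_{ℝ₊} K(x, y) f(y) dy`. -/
def opT (K : ℝ → ℝ → ℝ≥0∞) (f : ℝ → ℝ≥0∞) (x : ℝ) : ℝ≥0∞ :=
  ∫⁻ y in Ioi (0 : ℝ), K x y * f y

/-- The associate operator `(T'_K g)(y) = ∫_{ℝ₊} K(x, y) g(x) dx`. -/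
def opT' (K : ℝ → ℝ → ℝ≥0∞) (g : ℝ → ℝ≥0∞) (y : ℝ) : ℝ≥0∞ :=
  ∫⁻ x in Ioi (0 : ℝ), K x y * g x

/-- `(S g)(x) = ∫₀ˣ (T'_K g)(y) dy`. -/
def opS (K : ℝ → ℝ → ℝ≥0∞) (g : ℝ → ℝ≥0∞) (x : ℝ) : ℝ≥0∞ :=
  ∫⁻ y in Ioo (0 : ℝ) x, opT' K g y

/-- `U(x) = ∫₀ˣ u`. -/
def weightPrimitive (u : ℝ → ℝ) (x : ℝ) : ℝ≥0∞ :=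
  ∫⁻ z in Ioo (0 : ℝ) x, ENNReal.ofReal (u z)

end OrliczLorentz

end

/-! The proof is by duality. To bound `T_K f*` in the first gauge it is tested against functions g
with ∫ Ψ₁(g/u₁) u₁ ≤ 1. By Tonelli, ∫ (T_K f*) g = ∫ f* (T'_K g), and the hypothesis on S controls
the U₂-averages of T'_K g in the Ψ₂ gauge. Two facts carry the argument.

First (`modular_le_one_of_pairing`), pairings at most 1 force the modular to be at most 1. The test
function is a normalized multiple of φ₁(F)u₁, the case of equality in Young's inequality; truncation
of F keeps the integrals finite.

Second (`lintegral_antitone_mul_le`), if f is nonincreasing and H(x) = ∫₀ˣ h, then ∫ f h ≤ 10 as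
soon as the modulars of f and H/U₂ are at most 1. The half-line is cut at points where U₂ = 2^k. On
a block, f is at most its left value and ∫ h at most the right value of H. Young's inequality splits
this product, and monotonicity charges the Φ₂ term to the previous block and the Ψ₂ term to the next
one. -/

noncomputable section

namespace OrliczLorentz

/-! ### Primitives of densities on [0, ∞] -/

/-- The interval `(0, x)` of reals, for `x ∈ [0, ∞]`. -/
def initial (x : ℝ≥0∞) : Set ℝ := {y : ℝ | 0 < y ∧ ENNReal.ofReal y < x}

theorem measurableSet_initial (x : ℝ≥0∞) : MeasurableSet (initial x) :=
  measurableSet_Ioi.inter (ENNReal.measurable_ofReal measurableSet_Iio)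

theorem initial_zero : initial 0 = ∅ := by
  ext y; simp [initial]

theorem initial_top : initial ⊤ = Ioi 0 := by
  ext y; simp [initial]

theorem initial_ofReal (a : ℝ) : initial (ENNReal.ofReal a) = Ioo 0 a := by
  ext y
  simp only [initial, mem_ofPred_eq, mem_Ioo]
  constructor
  · rintro ⟨h, h'⟩
    exact ⟨h, ((ENNReal.ofReal_lt_ofReal_iff_of_nonneg h.le).1 h')⟩
  · rintro ⟨h, h'⟩
    exact ⟨h, ((ENNReal.ofReal_lt_ofReal_iff_of_nonneg h.le).2 h')⟩

theorem initial_mono : Monotone initial := fun _ _ h _ hy => ⟨hy.1, hy.2.trans_le h⟩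

theorem volume_initial (x : ℝ≥0∞) : volume (initial x) = x := by
  induction x with
  | top => simp [initial_top]
  | coe x =>
    rw [← ENNReal.ofReal_coe_nnreal, initial_ofReal]
    simp

theorem primitive_eq (φ : ℝ → ℝ) (x : ℝ≥0∞) :
    primitive φ x = ∫⁻ y in initial x, ENNReal.ofReal (φ y) := rfl

theorem primitive_zero (φ : ℝ → ℝ) : primitive φ 0 = 0 := by
  rw [primitive_eq, initial_zero]; simp

theorem primitive_mono (φ : ℝ → ℝ) : Monotone (primitive φ) := fun _ _ h =>
  lintegral_mono_set (initial_mono h)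

/-- The intervals are open at the right end, so they exhaust the limit interval. This continuity
from below, valid also at ∞, lets modulars pass from truncations to the function itself. -/
theorem primitive_iSup (φ : ℝ → ℝ) {t : ℕ → ℝ≥0∞} (ht : Monotone t) :
    primitive φ (⨆ n, t n) = ⨆ n, primitive φ (t n) := by
  have h : initial (⨆ n, t n) = ⋃ n, initial (t n) := by
    ext y
    simp [initial, lt_iSup_iff]
  simp only [primitive_eq]
  rw [h]
  exact setLIntegral_iUnion_of_directed (s := fun n => initial (t n)) _
    (initial_mono.comp ht).directed_le

/-- The primitive of a nondecreasing function is star-shaped. -/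
theorem primitive_mul_le {φ : ℝ → ℝ} (hφ : MonotoneOn φ (Ioi 0)) {c : ℝ} (hc : 0 < c)
    (hc1 : c ≤ 1) (x : ℝ≥0∞) :
    primitive φ (ENNReal.ofReal c * x) ≤ ENNReal.ofReal c * primitive φ x := by
  have key : ∀ y : ℝ, c * y ∈ initial (ENNReal.ofReal c * x) ↔ y ∈ initial x := by
    intro y
    simp only [initial, mem_ofPred_eq, mul_pos_iff_of_pos_left hc, ENNReal.ofReal_mul hc.le]
    rw [ENNReal.mul_lt_mul_iff_right (by simpa using hc) ENNReal.ofReal_ne_top]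
  simp only [primitive_eq]
  rw [← lintegral_indicator (measurableSet_initial _), ← lintegral_indicator
    (measurableSet_initial _)]
  -- The substitution y ↦ cy produces the factor c and leaves φ(cy) ≤ φ(y) to integrate.
  conv_lhs => rw [← Real.smul_map_volume_mul_left hc.ne']
  rw [lintegral_smul_measure, abs_of_pos hc, smul_eq_mul]
  refine mul_le_mul_right ?_ _
  have := lintegral_map_equiv (μ := volume)
    ((initial (ENNReal.ofReal c * x)).indicator fun y => ENNReal.ofReal (φ y))
    (MeasurableEquiv.mulLeft₀ c hc.ne')
  simp only [MeasurableEquiv.coe_mulLeft₀] at this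
  rw [this]
  refine lintegral_mono fun y => ?_
  by_cases hy : y ∈ initial x
  · rw [indicator_of_mem ((key y).2 hy), indicator_of_mem hy]
    exact ENNReal.ofReal_le_ofReal (hφ (mul_pos hc hy.1) hy.1
      (mul_le_of_le_one_left hy.1.le hc1))
  · rw [indicator_of_notMem (mt (key y).1 hy)]
    simp

/-! ### Young's inequality and its equality case -/

namespace NFunction

variable (Φ : NFunction)

theorem φ_pos {x : ℝ} (hx : 0 < x) : 0 < Φ.φ x := by
  have : Φ.φ x ∈ Ioi (0 : ℝ) := Φ.image_eq ▸ mem_image_of_mem _ hx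
  exact this

theorem exists_eq {t : ℝ} (ht : 0 < t) : ∃ x, 0 < x ∧ Φ.φ x = t := by
  have : t ∈ Φ.φ '' Ioi 0 := Φ.image_eq.symm ▸ ht
  exact this

/-- The density extended by zero, a monotone function on the whole line. -/
def ext : ℝ → ℝ := (Ioi 0).indicator Φ.φ

theorem ext_eq {x : ℝ} (hx : 0 < x) : Φ.ext x = Φ.φ x := indicator_of_mem (mem_Ioi.2 hx) _

theorem ext_nonneg (x : ℝ) : 0 ≤ Φ.ext x :=
  indicator_nonneg (fun _ hx => (Φ.φ_pos hx).le) _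

theorem ext_zero : Φ.ext 0 = 0 := indicator_of_notMem (by simp) _

theorem ext_monotone : Monotone Φ.ext := by
  intro x y hxy
  by_cases hx : 0 < x
  · rw [Φ.ext_eq hx, Φ.ext_eq (hx.trans_le hxy)]
    exact Φ.monotoneOn hx (hx.trans_le hxy : 0 < y) hxy
  · rw [ext, indicator_of_notMem (by simpa using hx)]
    exact Φ.ext_nonneg y

theorem ext_measurable : Measurable fun s => ENNReal.ofReal (Φ.ext s) :=
  ENNReal.measurable_ofReal.comp Φ.ext_monotone.measurable

theorem val_eq (x : ℝ≥0∞) : Φ.val x = ∫⁻ s in initial x, ENNReal.ofReal (Φ.ext s) :=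
  setLIntegral_congr_fun (measurableSet_initial x) fun s hs => by
    simp only [Φ.ext_eq hs.1]

theorem invDensity_le {s t : ℝ} (hs : 0 < s) (h : t ≤ Φ.φ s) : Φ.invDensity t ≤ s :=
  csInf_le ⟨0, fun _ hx => hx.1.le⟩ ⟨hs, h⟩

theorem le_invDensity {s t : ℝ} (hs : 0 < s) (ht : 0 < t) (h : Φ.φ s < t) :
    s ≤ Φ.invDensity t := by
  obtain ⟨x, hx, rfl⟩ := Φ.exists_eq ht
  refine le_csInf ⟨x, hx, le_rfl⟩ fun b hb => ?_
  by_contra! hbs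
  exact absurd (hb.2.trans (Φ.monotoneOn hb.1 hs hbs.le)) h.not_ge

theorem invDensity_monotoneOn : MonotoneOn Φ.invDensity (Ioi 0) := by
  intro s _ t ht hst
  obtain ⟨x, hx, rfl⟩ := Φ.exists_eq ht
  exact csInf_le_csInf ⟨0, fun _ hx => hx.1.le⟩ ⟨x, hx, le_rfl⟩
    fun b hb => ⟨hb.1, hst.trans hb.2⟩

/-- Both sides are the area of the part of the rectangle (0, x) × (0, y) above the graph of φ,
sliced in the two directions. Sliced horizontally, this area is comparable with the complementary
function. -/
theorem lintegral_volume_swap (x y : ℝ≥0∞) :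
    ∫⁻ s in initial x, volume (initial y ∩ Ioi (Φ.ext s)) =
      ∫⁻ t in initial y, volume (initial x ∩ {s | Φ.ext s < t}) := by
  have hm : MeasurableSet {p : ℝ × ℝ | Φ.ext p.1 < p.2} :=
    measurableSet_lt (Φ.ext_monotone.measurable.comp measurable_fst) measurable_snd
  have h := lintegral_lintegral_swap (μ := volume.restrict (initial x))
    (ν := volume.restrict (initial y))
    (f := fun s t => {p : ℝ × ℝ | Φ.ext p.1 < p.2}.indicator (fun _ => (1 : ℝ≥0∞)) (s, t))
    ((measurable_const.indicator hm).aemeasurable)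
  convert h using 2
  · ext s
    have : (fun t => {p : ℝ × ℝ | Φ.ext p.1 < p.2}.indicator (fun _ => (1 : ℝ≥0∞)) (s, t)) =
        (Ioi (Φ.ext s)).indicator 1 := by
      ext t; simp [indicator_apply]
    rw [this, lintegral_indicator_one measurableSet_Ioi, Measure.restrict_apply measurableSet_Ioi,
      inter_comm]
  · ext t
    have : (fun s => {p : ℝ × ℝ | Φ.ext p.1 < p.2}.indicator (fun _ => (1 : ℝ≥0∞)) (s, t)) =
        {s | Φ.ext s < t}.indicator 1 := by
      ext s; simp [indicator_apply]
    have hs : MeasurableSet {s | Φ.ext s < t} := Φ.ext_monotone.measurable measurableSet_Iio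
    rw [this, lintegral_indicator_one hs, Measure.restrict_apply hs, inter_comm]

/-- Young's inequality on `[0, ∞]`. -/
theorem young (x y : ℝ≥0∞) : x * y ≤ Φ.val x + Φ.compl y := by
  calc x * y = ∫⁻ _ in initial x, volume (initial y) := by
        rw [setLIntegral_const, volume_initial, volume_initial, mul_comm]
    _ ≤ ∫⁻ s in initial x,
          (ENNReal.ofReal (Φ.ext s) + volume (initial y ∩ Ioi (Φ.ext s))) := by
        refine lintegral_mono fun s => ?_
        -- Each vertical slice is cut at the height φ(s); the lower part integrates to Φ(x).
        have : initial y ⊆ Ioc 0 (Φ.ext s) ∪ (initial y ∩ Ioi (Φ.ext s)) := fun t ht => by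
          rcases le_or_gt t (Φ.ext s) with h | h
          · exact Or.inl ⟨ht.1, h⟩
          · exact Or.inr ⟨ht, h⟩
        calc volume (initial y) ≤ _ := measure_mono this
          _ ≤ _ := measure_union_le _ _
          _ = _ := by simp
    _ = Φ.val x + ∫⁻ s in initial x, volume (initial y ∩ Ioi (Φ.ext s)) := by
        rw [lintegral_add_left Φ.ext_measurable,
          ← val_eq]
    _ ≤ Φ.val x + Φ.compl y := by
        rw [lintegral_volume_swap]
        gcongr
        refine setLIntegral_mono' (measurableSet_initial y) fun t ht => ?_
        calc volume (initial x ∩ {s | Φ.ext s < t}) ≤ volume (Ioc 0 (Φ.invDensity t)) := by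
              refine measure_mono fun s hs => ⟨hs.1.1, Φ.le_invDensity hs.1.1 ht.1 ?_⟩
              simpa [Φ.ext_eq hs.1.1] using hs.2
          _ = _ := by simp

/-- The reverse of Young's inequality along the graph of the density. -/
theorem young_reverse {a : ℝ} (ha : 0 ≤ a) :
    Φ.val (ENNReal.ofReal a) + Φ.compl (ENNReal.ofReal (Φ.ext a)) ≤
      ENNReal.ofReal a * ENNReal.ofReal (Φ.ext a) := by
  rcases ha.eq_or_lt with rfl | ha
  · simp [ext_zero, val, compl, primitive_zero]
  have h1 : Φ.compl (ENNReal.ofReal (Φ.ext a)) ≤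
      ∫⁻ s in initial (ENNReal.ofReal a),
        volume (initial (ENNReal.ofReal (Φ.ext a)) ∩ Ioi (Φ.ext s)) := by
    rw [lintegral_volume_swap]
    refine setLIntegral_mono' (measurableSet_initial _) fun t ht => ?_
    change t ∈ initial _ at ht
    rw [initial_ofReal] at ht
    have hle : Φ.invDensity t ≤ a := Φ.invDensity_le ha (by rw [← Φ.ext_eq ha]; exact ht.2.le)
    calc ENNReal.ofReal (Φ.invDensity t) = volume (Ioo 0 (Φ.invDensity t)) := by simp
      _ ≤ _ := by
        refine measure_mono fun s hs => ⟨?_, ?_⟩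
        · rw [initial_ofReal]; exact ⟨hs.1, hs.2.trans_le hle⟩
        · rw [mem_ofPred_eq, Φ.ext_eq hs.1]
          by_contra! h
          exact hs.2.not_ge (Φ.invDensity_le hs.1 h)
  calc _ ≤ ∫⁻ s in initial (ENNReal.ofReal a), (ENNReal.ofReal (Φ.ext s) +
          volume (initial (ENNReal.ofReal (Φ.ext a)) ∩ Ioi (Φ.ext s))) := by
        rw [lintegral_add_left Φ.ext_measurable,
          ← val_eq]
        gcongr
    _ ≤ ∫⁻ s in initial (ENNReal.ofReal a), ENNReal.ofReal (Φ.ext a) := by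
        refine setLIntegral_mono' (measurableSet_initial _) fun s hs => ?_
        rw [initial_ofReal] at hs
        have hsa := Φ.ext_monotone hs.2.le
        calc _ ≤ ENNReal.ofReal (Φ.ext s) + volume (Ioo (Φ.ext s) (Φ.ext a)) := by
              gcongr
              rw [initial_ofReal]
              exact fun t ht => ⟨ht.2, ht.1.2⟩
          _ = _ := by
            rw [Real.volume_Ioo, ← ENNReal.ofReal_add (Φ.ext_nonneg _) (sub_nonneg.2 hsa)]
            congr 1; ring
    _ = _ := by rw [setLIntegral_const, volume_initial, mul_comm]

theorem val_zero : Φ.val 0 = 0 := primitive_zero _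

theorem val_one_ne_top : Φ.val 1 ≠ ⊤ := by
  refine ne_top_of_le_ne_top ?_ (le_self_add.trans (Φ.young_reverse zero_le_one) |>.trans' ?_)
  · exact ENNReal.mul_ne_top ENNReal.ofReal_ne_top ENNReal.ofReal_ne_top
  · simp

theorem val_eq_zero_iff {x : ℝ≥0∞} : Φ.val x = 0 ↔ x = 0 := by
  refine ⟨fun h => ?_, fun h => h ▸ Φ.val_zero⟩
  rw [val_eq, setLIntegral_eq_zero_iff (measurableSet_initial x) Φ.ext_measurable] at h
  rw [← volume_initial x]
  refine measure_mono_null (fun s hs => ?_) (show volume {s | ¬ (s ∈ initial x →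
    ENNReal.ofReal (Φ.ext s) = 0)} = 0 from h)
  simp only [mem_ofPred_eq, Classical.not_imp, ENNReal.ofReal_eq_zero, not_le]
  exact ⟨hs, by rw [Φ.ext_eq hs.1]; exact Φ.φ_pos hs.1⟩

end NFunction

theorem primitive_measurable (φ : ℝ → ℝ) : Measurable (primitive φ) :=
  (primitive_mono φ).measurable


/-! ### Duality: from pairings to modulars -/

theorem IsWeight.aemeasurable {u : ℝ → ℝ} (hu : IsWeight u) :
    AEMeasurable (fun x => ENNReal.ofReal (u x)) (volume.restrict (Ioi (0 : ℝ))) :=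
  hu.locallyIntegrable.aestronglyMeasurable.aemeasurable.ennreal_ofReal

theorem IsWeight.setLIntegral_lt_top {u : ℝ → ℝ} (hu : IsWeight u) {a b : ℝ} (ha : 0 < a) :
    ∫⁻ x in Icc a b, ENNReal.ofReal (u x) < ⊤ := by
  have h : IntegrableOn u (Icc a b) :=
    hu.locallyIntegrable.integrableOn_compact_subset (fun x hx => ha.trans_le hx.1) isCompact_Icc
  exact h.lintegral_lt_top

/-- The modular inequality dual to a bound for pairings, for a minorant `G` of `F` on which the
modulars are finite. -/
theorem modular_le_one_of_pairing_of_finite (Φ : NFunction) {u : ℝ → ℝ} (hu : IsWeight u)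
    {F G : ℝ → ℝ≥0∞} (hG : MPlus G) (hGF : ∀ x, G x ≤ F x) (hGtop : ∀ x, G x ≠ ⊤)
    (hfin : ∫⁻ x in Ioi (0 : ℝ),
      G x * ENNReal.ofReal (Φ.ext (G x).toReal) * ENNReal.ofReal (u x) ≠ ⊤)
    (h : ∀ g : ℝ → ℝ≥0∞, MPlus g → (∀ x, 0 < x → u x = 0 → g x = 0) →
      ∫⁻ x in Ioi (0 : ℝ), Φ.compl (g x / ENNReal.ofReal (u x)) * ENNReal.ofReal (u x) ≤ 1 →
      ∫⁻ x in Ioi (0 : ℝ), F x * g x ≤ 1) :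
    ∫⁻ x in Ioi (0 : ℝ), Φ.val (G x) * ENNReal.ofReal (u x) ≤ 1 := by
  -- φ(G) is the extremal choice: Young's inequality for G and p is an equality.
  set p : ℝ → ℝ≥0∞ := fun x => ENNReal.ofReal (Φ.ext (G x).toReal) with hp
  have hpm : AEMeasurable p (volume.restrict (Ioi (0 : ℝ))) :=
    Φ.ext_measurable.comp_aemeasurable (AEMeasurable.ennreal_toReal hG)
  have hum := hu.aemeasurable
  set I := ∫⁻ x in Ioi (0 : ℝ), Φ.compl (p x) * ENNReal.ofReal (u x) with hI
  set J := ∫⁻ x in Ioi (0 : ℝ), G x * p x * ENNReal.ofReal (u x) with hJ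
  set V := ∫⁻ x in Ioi (0 : ℝ), Φ.val (G x) * ENNReal.ofReal (u x) with hV
  have hVI : V + I ≤ J := by
    have hm : AEMeasurable (fun x => Φ.val (G x) * ENNReal.ofReal (u x))
        (volume.restrict (Ioi (0 : ℝ))) :=
      ((primitive_measurable Φ.φ).comp_aemeasurable hG).mul hum
    rw [hV, hI, ← lintegral_add_left' hm]
    refine lintegral_mono fun x => ?_
    simp only [← add_mul]
    gcongr
    have := Φ.young_reverse (a := (G x).toReal) ENNReal.toReal_nonneg
    rwa [ENNReal.ofReal_toReal (hGtop x)] at this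
  have hItop : I ≠ ⊤ := ne_top_of_le_ne_top hfin (le_add_self.trans hVI)
  -- Since the complementary function is star-shaped, dividing p by m ≥ 1 brings its modular down to
  -- I/m ≤ 1, so pu/m is an admissible test function.
  set m := max 1 I with hm
  have hmtop : m ≠ ⊤ := by simp [hm, hItop]
  have hm1 : 1 ≤ m := le_max_left _ _
  have hm0 : m ≠ 0 := (zero_lt_one.trans_le hm1).ne'
  have hmi : m⁻¹ ≠ ⊤ := ENNReal.inv_ne_top.2 hm0
  have hmi1 : m⁻¹ ≤ 1 := ENNReal.inv_le_one.2 hm1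
  have hscale : ∀ t : ℝ≥0∞, Φ.compl (m⁻¹ * t) ≤ m⁻¹ * Φ.compl t := by
    intro t
    have hc : 0 < m⁻¹.toReal := ENNReal.toReal_pos (ENNReal.inv_ne_zero.2 hmtop) hmi
    have := primitive_mul_le Φ.invDensity_monotoneOn hc
      (by simpa using ENNReal.toReal_mono ENNReal.one_ne_top hmi1) t
    rwa [ENNReal.ofReal_toReal hmi] at this
  have hJm : J ≤ m := by
    have key := h (fun x => m⁻¹ * p x * ENNReal.ofReal (u x))
      ((hpm.const_mul _).mul hum) (fun x _ hx => by simp [hx]) ?_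
    · have : m⁻¹ * J ≤ 1 := by
        refine le_trans ?_ key
        rw [hJ, ← lintegral_const_mul' _ _ hmi]
        refine lintegral_mono fun x => ?_
        calc m⁻¹ * (G x * p x * ENNReal.ofReal (u x))
            = G x * (m⁻¹ * p x * ENNReal.ofReal (u x)) := by ring
          _ ≤ _ := by gcongr; exact hGF x
      calc J = m * (m⁻¹ * J) := by rw [← mul_assoc, ENNReal.mul_inv_cancel hm0 hmtop, one_mul]
        _ ≤ m * 1 := by gcongr
        _ = m := mul_one m
    · calc _ ≤ ∫⁻ x in Ioi (0 : ℝ), m⁻¹ * (Φ.compl (p x) * ENNReal.ofReal (u x)) := by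
            refine lintegral_mono fun x => ?_
            by_cases hx : ENNReal.ofReal (u x) = 0
            · simp [hx]
            · rw [ENNReal.mul_div_cancel_right hx ENNReal.ofReal_ne_top, ← mul_assoc]
              gcongr
              exact hscale _
        _ = m⁻¹ * I := lintegral_const_mul' _ _ hmi
        _ ≤ m⁻¹ * m := by gcongr; exact le_max_right _ _
        _ = 1 := ENNReal.inv_mul_cancel hm0 hmtop
  -- If I ≤ 1, then V ≤ J ≤ 1. Otherwise V + I ≤ J ≤ I, and cancelling the finite I gives V = 0.
  rcases le_total I 1 with h1 | h1
  · rw [hm, max_eq_left h1] at hJm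
    exact (le_self_add.trans hVI).trans hJm
  · rw [hm, max_eq_right h1] at hJm
    have : V + I ≤ 0 + I := by simpa using hVI.trans hJm
    exact ((ENNReal.add_le_add_iff_right hItop).1 this).trans zero_le_one

/-- The truncation `min(F, n)` restricted to `(1/(n+1), n+1)`. -/
def trunc (F : ℝ → ℝ≥0∞) (n : ℕ) : ℝ → ℝ≥0∞ :=
  (Ioo (1 / ((n : ℝ) + 1)) ((n : ℝ) + 1)).indicator fun x => min (F x) n

theorem trunc_le (F : ℝ → ℝ≥0∞) (n : ℕ) (x : ℝ) : trunc F n x ≤ F x :=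
  indicator_le' (fun _ _ => min_le_left _ _) (fun _ _ => zero_le) x

theorem trunc_mono (F : ℝ → ℝ≥0∞) (x : ℝ) : Monotone fun n => trunc F n x := by
  intro n m hnm
  have hnm' : (n : ℝ) ≤ m := by exact_mod_cast hnm
  have hsub : Ioo (1 / ((n : ℝ) + 1)) ((n : ℝ) + 1) ⊆ Ioo (1 / ((m : ℝ) + 1)) ((m : ℝ) + 1) :=
    Ioo_subset_Ioo (by gcongr) (by gcongr)
  calc trunc F n x ≤ (Ioo (1 / ((n : ℝ) + 1)) ((n : ℝ) + 1)).indicator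
        (fun x => min (F x) m) x :=
        indicator_le_indicator (min_le_min le_rfl (by exact_mod_cast hnm))
    _ ≤ trunc F m x := indicator_le_indicator_of_subset hsub (fun _ => zero_le) x

theorem iSup_trunc (F : ℝ → ℝ≥0∞) {x : ℝ} (hx : 0 < x) : ⨆ n, trunc F n x = F x := by
  refine le_antisymm (iSup_le fun n => trunc_le F n x) ?_
  refine le_of_forall_lt fun c hc => ?_
  obtain ⟨N₁, h₁⟩ := exists_nat_one_div_lt hx
  obtain ⟨N₂, h₂⟩ := exists_nat_gt x
  obtain ⟨N₃, h₃⟩ := ENNReal.exists_nat_gt hc.ne_top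
  set n := max N₁ (max N₂ N₃)
  have hn₁ : (N₁ : ℝ) ≤ n := by exact_mod_cast le_max_left _ _
  have hn₂ : (N₂ : ℝ) ≤ n := by exact_mod_cast (le_max_left _ _).trans (le_max_right _ _)
  have hn₃ : (N₃ : ℝ≥0∞) ≤ n := by exact_mod_cast (le_max_right _ _).trans (le_max_right _ _)
  refine lt_of_lt_of_le ?_ (le_iSup _ n)
  rw [trunc, indicator_of_mem]
  · exact lt_min hc (h₃.trans_le hn₃)
  · refine ⟨lt_of_le_of_lt ?_ h₁, by linarith⟩
    gcongr

/-- A function whose pairings with the unit ball of the complementary class are at most `1` has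
modular at most `1`. -/
theorem modular_le_one_of_pairing (Φ : NFunction) {u : ℝ → ℝ} (hu : IsWeight u)
    {F : ℝ → ℝ≥0∞} (hF : MPlus F)
    (h : ∀ g : ℝ → ℝ≥0∞, MPlus g → (∀ x, 0 < x → u x = 0 → g x = 0) →
      ∫⁻ x in Ioi (0 : ℝ), Φ.compl (g x / ENNReal.ofReal (u x)) * ENNReal.ofReal (u x) ≤ 1 →
      ∫⁻ x in Ioi (0 : ℝ), F x * g x ≤ 1) :
    ∫⁻ x in Ioi (0 : ℝ), Φ.val (F x) * ENNReal.ofReal (u x) ≤ 1 := by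
  have hm : ∀ n, MPlus (trunc F n) := fun n =>
    (AEMeasurable.inf hF aemeasurable_const).indicator measurableSet_Ioo
  have hle : ∀ n x, trunc F n x ≤ n := fun n x =>
    indicator_le' (fun _ _ => min_le_right _ _) (fun _ _ => zero_le) x
  have htop : ∀ n x, trunc F n x ≠ ⊤ := fun n x =>
    ne_top_of_le_ne_top (ENNReal.natCast_ne_top n) (hle n x)
  have hn : ∀ n, ∫⁻ x in Ioi (0 : ℝ), Φ.val (trunc F n x) * ENNReal.ofReal (u x) ≤ 1 := by
    intro n
    -- Finiteness holds because the truncation is bounded by n and lives on a compact subset of (0,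
    -- ∞), where u is integrable.
    refine modular_le_one_of_pairing_of_finite Φ hu (hm n) (trunc_le F n) (htop n) ?_ h
    set c : ℝ≥0∞ := n * ENNReal.ofReal (Φ.ext n)
    have hpos : (0 : ℝ) < 1 / ((n : ℝ) + 1) := by positivity
    have hbound : ∫⁻ x in Ioi (0 : ℝ), trunc F n x *
        ENNReal.ofReal (Φ.ext (trunc F n x).toReal) * ENNReal.ofReal (u x) ≤
        c * ∫⁻ x in Icc (1 / ((n : ℝ) + 1)) ((n : ℝ) + 1), ENNReal.ofReal (u x) := by
      have hc : c ≠ ⊤ := ENNReal.mul_ne_top (ENNReal.natCast_ne_top n) ENNReal.ofReal_ne_top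
      rw [← lintegral_const_mul' _ _ hc, ← lintegral_indicator measurableSet_Icc]
      refine (setLIntegral_le_lintegral _ _).trans (lintegral_mono fun x => ?_)
      by_cases hx : x ∈ Ioo (1 / ((n : ℝ) + 1)) ((n : ℝ) + 1)
      · rw [indicator_of_mem (Ioo_subset_Icc_self hx)]
        refine mul_le_mul_left (mul_le_mul' (hle n x) (ENNReal.ofReal_le_ofReal ?_)) _
        · refine Φ.ext_monotone ?_
          simpa using ENNReal.toReal_mono (ENNReal.natCast_ne_top n) (hle n x)
      · rw [trunc, indicator_of_notMem hx]; simp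
    refine ne_top_of_le_ne_top (ENNReal.mul_ne_top ?_ ?_) hbound
    · exact ENNReal.mul_ne_top (ENNReal.natCast_ne_top n) ENNReal.ofReal_ne_top
    · exact (hu.setLIntegral_lt_top hpos).ne
  calc _ = ∫⁻ x in Ioi (0 : ℝ), ⨆ n, Φ.val (trunc F n x) * ENNReal.ofReal (u x) := by
        refine setLIntegral_congr_fun measurableSet_Ioi fun x hx => ?_
        simp only [← ENNReal.iSup_mul, NFunction.val]
        rw [← primitive_iSup _ (trunc_mono F x), iSup_trunc F hx]
    _ = ⨆ n, ∫⁻ x in Ioi (0 : ℝ), Φ.val (trunc F n x) * ENNReal.ofReal (u x) := by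
        refine lintegral_iSup' (fun n => ((primitive_measurable Φ.φ).comp_aemeasurable
          (hm n)).mul hu.aemeasurable) (Filter.Eventually.of_forall fun x n m hnm => ?_)
        have := primitive_mono Φ.φ (trunc_mono F x hnm)
        dsimp only [NFunction.val]
        gcongr
    _ ≤ 1 := iSup_le hn


/-! ### Pairing a nonincreasing function through the levels of the weight primitive -/

theorem weightPrimitive_add (u : ℝ → ℝ) {x y : ℝ} (hx : 0 < x) (hxy : x ≤ y) :
    weightPrimitive u y =
      weightPrimitive u x + ∫⁻ z in Ico x y, ENNReal.ofReal (u z) := by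
  rw [weightPrimitive, weightPrimitive, ← lintegral_union measurableSet_Ico,
    Ioo_union_Ico_eq_Ioo hx hxy]
  exact disjoint_left.2 fun z hz hz' => hz.2.not_ge hz'.1

theorem weightPrimitive_mono (u : ℝ → ℝ) : Monotone (weightPrimitive u) := fun _ _ h =>
  lintegral_mono_set (Ioo_subset_Ioo_right h)

/-- Local integrability on (0, ∞) allows infinite mass on (0, x) only through a singularity at 0,
which every (0, y) shares. -/
theorem IsWeight.weightPrimitive_eq_top {u : ℝ → ℝ} (hu : IsWeight u) {x y : ℝ}
    (h : weightPrimitive u x = ⊤) (hy : 0 < y) : weightPrimitive u y = ⊤ := by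
  rcases le_total x y with hxy | hxy
  · exact top_unique (h ▸ weightPrimitive_mono u hxy)
  · rw [weightPrimitive_add u hy hxy, ENNReal.add_eq_top] at h
    refine h.resolve_right (ne_top_of_le_ne_top (hu.setLIntegral_lt_top (b := x) hy).ne ?_)
    exact lintegral_mono_set Ico_subset_Icc_self

theorem exists_lt_weightPrimitive {u : ℝ → ℝ}
    (htop : ∫⁻ x in Ioi (0 : ℝ), ENNReal.ofReal (u x) = ⊤) {c : ℝ≥0∞} (hc : c ≠ ⊤) :
    ∃ n : ℕ, c < weightPrimitive u n := by
  have h : Ioi (0 : ℝ) = ⋃ n : ℕ, Ioo (0 : ℝ) n := by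
    ext y
    simp only [mem_Ioi, mem_iUnion, mem_Ioo, exists_and_left]
    exact ⟨fun h => ⟨h, exists_nat_gt y⟩, fun h => h.1⟩
  have hd : Monotone fun n : ℕ => Ioo (0 : ℝ) n := fun n m hnm =>
    Ioo_subset_Ioo_right (by exact_mod_cast hnm)
  rw [h, setLIntegral_iUnion_of_directed _ hd.directed_le] at htop
  exact lt_iSup_iff.1 (htop.symm ▸ hc.lt_top)

/-- A finite weight primitive of infinite total mass takes every positive value. -/
theorem IsWeight.exists_weightPrimitive_eq {u : ℝ → ℝ} (hu : IsWeight u)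
    (hfin : ∀ x, weightPrimitive u x ≠ ⊤)
    (htop : ∫⁻ x in Ioi (0 : ℝ), ENNReal.ofReal (u x) = ⊤) {c : ℝ≥0∞} (hc0 : c ≠ 0)
    (hc : c ≠ ⊤) : ∃ x, 0 < x ∧ weightPrimitive u x = c := by
  have hnn : ∀ b, 0 ≤ᵐ[volume.restrict (Ioo 0 b)] u := fun b =>
    (ae_restrict_iff' measurableSet_Ioo).2 (Filter.Eventually.of_forall fun x hx =>
      hu.nonneg x hx.1)
  have hint : ∀ b, IntegrableOn u (Ioo 0 b) := fun b =>
    ⟨hu.locallyIntegrable.aestronglyMeasurable.mono_set Ioo_subset_Ioi_self,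
      (hasFiniteIntegral_iff_ofReal (hnn b)).2 (hfin b).lt_top⟩
  -- Extension by zero makes the primitive continuous down to 0, as the intermediate value theorem
  -- requires.
  set v : ℝ → ℝ := (Ioi 0).indicator u with hv
  have hvint : ∀ b, IntegrableOn v (Iio b) := fun b => by
    rw [IntegrableOn, hv, integrable_indicator_iff measurableSet_Ioi, IntegrableOn,
      Measure.restrict_restrict measurableSet_Ioi, Ioi_inter_Iio]
    exact hint b
  have hvint' : ∀ a b, IntervalIntegrable v volume a b := fun a b =>
    ⟨(hvint (b + 1)).mono_set fun x hx => hx.2.trans_lt (by linarith),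
      (hvint (a + 1)).mono_set fun x hx => hx.2.trans_lt (by linarith)⟩
  have hV : ∀ x, 0 ≤ x → weightPrimitive u x = ENNReal.ofReal (∫ t in (0 : ℝ)..x, v t) := by
    intro x hx
    rw [intervalIntegral.integral_of_le hx, integral_Ioc_eq_integral_Ioo,
      setIntegral_congr_fun (g := u) measurableSet_Ioo fun t ht => ?_,
      ofReal_integral_eq_lintegral_ofReal (hint x) (hnn x), weightPrimitive]
    exact indicator_of_mem (mem_Ioi.2 ht.1) _
  obtain ⟨n, hn⟩ := exists_lt_weightPrimitive htop hc
  rw [hV n n.cast_nonneg] at hn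
  have hcn : c.toReal ≤ ∫ t in (0 : ℝ)..n, v t := by
    rw [← ENNReal.ofReal_toReal hc] at hn
    exact (ENNReal.ofReal_lt_ofReal_iff'.1 hn).1.le
  obtain ⟨x, hx, hxc⟩ := intermediate_value_Icc (n.cast_nonneg : (0 : ℝ) ≤ n)
    (intervalIntegral.continuous_primitive hvint' 0).continuousOn
    (show c.toReal ∈ Icc _ _ from ⟨by simp, hcn⟩)
  have hx' : weightPrimitive u x = c := by
    rw [hV x hx.1]
    simp only [hxc, ENNReal.ofReal_toReal hc]
  refine ⟨x, hx.1.lt_of_ne ?_, hx'⟩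
  rintro rfl
  simp [weightPrimitive] at hx'
  exact hc0 hx'.symm

theorem NFunction.mul_mul_le (Φ : NFunction) {b H q : ℝ≥0∞} (hq : q ≠ 0) (hq' : q ≠ ⊤) :
    b * H ≤ q * Φ.val b + q * Φ.compl (H / q) := by
  calc b * H = q * (b * (H / q)) := by
        rw [mul_left_comm, ENNReal.mul_div_cancel hq hq']
    _ ≤ q * (Φ.val b + Φ.compl (H / q)) := by gcongr; exact Φ.young _ _
    _ = _ := mul_add _ _ _

theorem two_zpow_add_one (k : ℤ) : (2 : ℝ≥0∞) ^ (k + 1) = 2 * 2 ^ k := by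
  rw [ENNReal.zpow_add two_ne_zero ENNReal.ofNat_ne_top, zpow_one, mul_comm]

/-- The pairing estimate for nonincreasing functions, when the weight has a finite primitive. -/
theorem lintegral_antitone_mul_le_of_finite (Φ : NFunction) {u : ℝ → ℝ} (hu : IsWeight u)
    (hfin : ∀ x, weightPrimitive u x ≠ ⊤)
    (htop : ∫⁻ x in Ioi (0 : ℝ), ENNReal.ofReal (u x) = ⊤)
    {f h : ℝ → ℝ≥0∞} (hf : AntitoneOn f (Ioi 0)) (hh : MPlus h)
    (hΦ : ∫⁻ x in Ioi (0 : ℝ), Φ.val (f x) * ENNReal.ofReal (u x) ≤ 1)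
    (hΨ : ∫⁻ x in Ioi (0 : ℝ), Φ.compl ((∫⁻ y in Ioo 0 x, h y) / weightPrimitive u x) *
      ENNReal.ofReal (u x) ≤ 1) :
    ∫⁻ x in Ioi (0 : ℝ), f x * h x ≤ 10 := by
  set H : ℝ → ℝ≥0∞ := fun x => ∫⁻ y in Ioo 0 x, h y with hH
  have hHmono : Monotone H := fun _ _ hxy => lintegral_mono_set (Ioo_subset_Ioo_right hxy)
  have h2 : ∀ k : ℤ, (2 : ℝ≥0∞) ^ k ≠ 0 := fun k =>
    (ENNReal.zpow_pos two_ne_zero ENNReal.ofNat_ne_top k).ne'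
  have h2' : ∀ k : ℤ, (2 : ℝ≥0∞) ^ k ≠ ⊤ := fun k =>
    (ENNReal.zpow_lt_top two_ne_zero ENNReal.ofNat_ne_top k).ne
  choose x hx0 hxU using fun k : ℤ => hu.exists_weightPrimitive_eq hfin htop (h2 k) (h2' k)
  have hlt : ∀ k, x k < x (k + 1) := fun k => by
    by_contra! hle
    have := weightPrimitive_mono u hle
    rw [hxU, hxU, two_zpow_add_one, two_mul] at this
    exact this.not_gt (ENNReal.lt_add_right (h2' k) (h2 k))
  have hmono : Monotone x := monotone_int_of_le_succ fun k => (hlt k).le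
  set E : ℤ → Set ℝ := fun k => Ico (x k) (x (k + 1)) with hE
  have hEpos : ∀ k, E k ⊆ Ioi 0 := fun k y hy => (hx0 k).trans_le hy.1
  have hEm : ∀ k, MeasurableSet (E k) := fun k => measurableSet_Ico
  have hEd : Pairwise (Function.onFun Disjoint E) := by
    simpa [hE, Int.succ_eq_succ] using hmono.pairwise_disjoint_on_Ico_succ
  have hEu : ∀ k, ∫⁻ y in E k, ENNReal.ofReal (u y) = 2 ^ k := fun k => by
    have := weightPrimitive_add u (hx0 k) (hlt k).le
    rw [hxU, hxU, two_zpow_add_one, two_mul] at this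
    exact ((ENNReal.add_right_inj (h2' k)).1 this).symm
  have hconst : ∀ k (c : ℝ≥0∞) (F : ℝ → ℝ≥0∞), (∀ y ∈ E k, c ≤ F y) →
      2 ^ k * c ≤ ∫⁻ y in E k, F y * ENNReal.ofReal (u y) := fun k c F hc => by
    calc 2 ^ k * c = c * ∫⁻ y in E k, ENNReal.ofReal (u y) := by rw [hEu, mul_comm]
      _ ≤ ∫⁻ y in E k, c * ENNReal.ofReal (u y) := lintegral_const_mul_le _ _
      _ ≤ _ := setLIntegral_mono' (hEm k) fun y hy => by gcongr; exact hc y hy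
  have hsum : ∀ F : ℝ → ℝ≥0∞, ∑' k, ∫⁻ y in E k, F y ≤ ∫⁻ y in Ioi 0, F y := fun F => by
    rw [← lintegral_iUnion hEm hEd]
    exact lintegral_mono_set (iUnion_subset hEpos)
  set P : ℤ → ℝ≥0∞ := fun k => ∫⁻ y in E k, Φ.val (f y) * ENNReal.ofReal (u y)
  set Q : ℤ → ℝ≥0∞ := fun k => ∫⁻ y in E k, Φ.compl (H y / weightPrimitive u y) *
    ENNReal.ofReal (u y)
  have hPsum : ∑' k, P k ≤ 1 := (hsum _).trans hΦ
  have hQsum : ∑' k, Q k ≤ 1 := (hsum _).trans hΨ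
  have hP : ∀ k, 2 ^ k * Φ.val (f (x (k + 1))) ≤ P k := fun k =>
    hconst k _ (fun y => Φ.val (f y)) fun y hy =>
      primitive_mono _ (hf (hEpos k hy) (hx0 _) hy.2.le)
  have hQ : ∀ k, 2 ^ k * Φ.compl (H (x k) / 2 ^ (k + 1)) ≤ Q k := fun k =>
    hconst k _ (fun y => Φ.compl (H y / weightPrimitive u y)) fun y hy =>
      primitive_mono _ (ENNReal.div_le_div (hHmono hy.1)
        ((weightPrimitive_mono u hy.2.le).trans_eq (hxU _)))
  -- Young's inequality is scaled by 2^(k+1), an upper bound for U on block k. The block has mass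
  -- only 2^k, hence the factor 2 before Q.
  have hyoung : ∀ (b : ℝ≥0∞) (k : ℤ),
      b * H (x k) ≤ 2 ^ (k + 1) * Φ.val b + 2 * Q k := fun b k => by
    refine (Φ.mul_mul_le (h2 (k + 1)) (h2' (k + 1))).trans ?_
    refine add_le_add le_rfl ?_
    conv_lhs => rw [two_zpow_add_one, mul_assoc, ← two_zpow_add_one]
    gcongr
    exact hQ k
  -- Block k - 1 is the last one on which f ≥ f(x k), and its mass 2^(k-1) is one eighth of the
  -- scale 2^(k+2).
  have hblock : ∀ k, ∫⁻ y in E k, f y * h y ≤ 8 * P (k - 1) + 2 * Q (k + 1) := fun k => by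
    calc ∫⁻ y in E k, f y * h y ≤ ∫⁻ y in E k, f (x k) * h y :=
          setLIntegral_mono' (hEm k) fun y hy => by
            gcongr; exact hf (hx0 k) (hEpos k hy) hy.1
      _ = f (x k) * ∫⁻ y in E k, h y :=
          lintegral_const_mul'' _ (AEMeasurable.mono_set (hEpos k) hh)
      _ ≤ f (x k) * H (x (k + 1)) := by
          gcongr
          exact lintegral_mono_set fun y hy => ⟨hEpos k hy, hy.2⟩
      _ ≤ _ := hyoung _ _
      _ ≤ _ := by
          refine add_le_add ?_ le_rfl
          have h3 : (2 : ℝ≥0∞) ^ (k + 1 + 1) = 8 * 2 ^ (k - 1) := by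
            have : k + 1 + 1 = k - 1 + 1 + 1 + 1 := by ring
            rw [this, two_zpow_add_one, two_zpow_add_one, two_zpow_add_one]
            ring
          rw [h3, mul_assoc]
          gcongr
          simpa using hP (k - 1)
  -- The blocks miss the initial stretch where U = 0. As f may be infinite there, h has to vanish
  -- almost everywhere on it.
  set N : Set ℝ := {y | 0 < y ∧ weightPrimitive u y = 0}
  have hNpos : N ⊆ Ioi 0 := fun y hy => hy.1
  have hN : ∫⁻ y in N, h y = 0 := by
    by_contra hc
    set c := ∫⁻ y in N, h y
    have hcle : ∀ k, c ≤ H (x k) := fun k => lintegral_mono_set fun y hy => ⟨hy.1, by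
      by_contra! hle
      have := weightPrimitive_mono u hle
      rw [hxU, hy.2] at this
      exact h2 k (le_zero_iff.1 this)⟩
    set e : ℕ → ℤ := fun n => -(n : ℤ) - 1
    have he : Function.Injective e := fun n m hnm => by simp only [e] at hnm; omega
    -- Otherwise a fixed c > 0 lies below every H(x k). Young's inequality with b = 1 at the scales
    -- 2^(-n) bounds c by the terms of a convergent series, and summing over n is contradictory.
    have hstep : ∀ n : ℕ, c ≤ 2⁻¹ ^ n * Φ.val 1 + 2 * Q (e n) := fun n => by
      have := hyoung 1 (e n)
      rw [one_mul] at this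
      refine (hcle _).trans (this.trans_eq ?_)
      congr 2
      simp only [e, sub_add_cancel]
      rw [ENNReal.zpow_neg, zpow_natCast, ENNReal.inv_pow]
    have htot := ENNReal.tsum_le_tsum hstep
    rw [ENNReal.tsum_const_eq_top_of_ne_zero hc, ENNReal.tsum_add, ENNReal.tsum_mul_left,
      ENNReal.tsum_mul_right, ENNReal.tsum_geometric, ENNReal.one_sub_inv_two, inv_inv] at htot
    refine (ENNReal.add_lt_top.2 ⟨ENNReal.mul_lt_top ENNReal.ofNat_lt_top
      Φ.val_one_ne_top.lt_top, ENNReal.mul_lt_top ENNReal.ofNat_lt_top ?_⟩).not_ge htot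
    exact ((ENNReal.tsum_comp_le_tsum_of_injective he Q).trans hQsum).trans_lt ENNReal.one_lt_top
  have hN' : ∫⁻ y in N, f y * h y = 0 := by
    have h0 := (lintegral_eq_zero_iff' (AEMeasurable.mono_set hNpos hh)).1 hN
    rw [lintegral_congr_ae (g := 0) (by filter_upwards [h0] with y hy; simp [hy])]
    simp
  have hcover : Ioi (0 : ℝ) ⊆ N ∪ ⋃ k, E k := fun y hy => by
    by_cases h0 : weightPrimitive u y = 0
    · exact Or.inl ⟨hy, h0⟩
    · refine Or.inr ?_
      obtain ⟨k, hk, hk'⟩ := ENNReal.exists_mem_Ico_zpow h0 (hfin y) ENNReal.one_lt_two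
        ENNReal.ofNat_ne_top
      have lt_of : ∀ j : ℤ, weightPrimitive u y < 2 ^ j → y < x j := fun j hj => by
        by_contra! hle
        exact (((hxU j).symm.trans_le (weightPrimitive_mono u hle))).not_gt hj
      have of_lt : ∀ j : ℤ, (2 : ℝ≥0∞) ^ j < weightPrimitive u y → x j < y := fun j hj => by
        by_contra! hle
        exact ((weightPrimitive_mono u hle).trans_eq (hxU j)).not_gt hj
      rw [mem_iUnion]
      rcases le_or_gt (x k) y with hxy | hxy
      · exact ⟨k, hxy, lt_of _ hk'⟩
      -- Here y lies left of x k although U(y) ≥ 2^k: U is flat between them, so y belongs to the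
      -- preceding block.
      · refine ⟨k - 1, (of_lt _ (lt_of_lt_of_le ?_ hk)).le, by simpa using hxy⟩
        have := two_zpow_add_one (k - 1)
        rw [sub_add_cancel] at this
        rw [this, two_mul]
        exact ENNReal.lt_add_right (h2' _) (h2 _)
  calc ∫⁻ y in Ioi (0 : ℝ), f y * h y ≤ ∫⁻ y in N ∪ ⋃ k, E k, f y * h y :=
        lintegral_mono_set hcover
    _ ≤ (∫⁻ y in N, f y * h y) + ∫⁻ y in ⋃ k, E k, f y * h y := lintegral_union_le _ _ _
    _ ≤ 0 + ∑' k, (8 * P (k - 1) + 2 * Q (k + 1)) := by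
        rw [hN']
        gcongr
        exact (lintegral_iUnion_le _ _).trans (ENNReal.tsum_le_tsum hblock)
    _ = 8 * ∑' k, P k + 2 * ∑' k, Q k := by
        rw [zero_add, ENNReal.tsum_add, ENNReal.tsum_mul_left, ENNReal.tsum_mul_left,
          ← (Equiv.subRight (1 : ℤ)).tsum_eq P, ← (Equiv.addRight (1 : ℤ)).tsum_eq Q]
        rfl
    _ ≤ 8 * 1 + 2 * 1 := by gcongr
    _ = 10 := by norm_num

/-- The pairing of a nonincreasing function `f` with `h` is bounded when the modulars of `f` and
of the averages of `h` with respect to the weight are at most `1`. -/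
theorem lintegral_antitone_mul_le (Φ : NFunction) {u : ℝ → ℝ} (hu : IsWeight u)
    (htop : ∫⁻ x in Ioi (0 : ℝ), ENNReal.ofReal (u x) = ⊤)
    {f h : ℝ → ℝ≥0∞} (hf : AntitoneOn f (Ioi 0)) (hh : MPlus h)
    (hΦ : ∫⁻ x in Ioi (0 : ℝ), Φ.val (f x) * ENNReal.ofReal (u x) ≤ 1)
    (hΨ : ∫⁻ x in Ioi (0 : ℝ), Φ.compl ((∫⁻ y in Ioo 0 x, h y) / weightPrimitive u x) *
      ENNReal.ofReal (u x) ≤ 1) :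
    ∫⁻ x in Ioi (0 : ℝ), f x * h x ≤ 10 := by
  by_cases hfin : ∀ x, weightPrimitive u x ≠ ⊤
  · exact lintegral_antitone_mul_le_of_finite Φ hu hfin htop hf hh hΦ hΨ
  push Not at hfin
  obtain ⟨x, hx⟩ := hfin
  -- With infinite mass near 0, any positive value of f at t persists on (0, t) and makes the
  -- modular infinite.
  have hf0 : ∀ t ∈ Ioi (0 : ℝ), f t = 0 := fun t ht => by
    rw [← Φ.val_eq_zero_iff]
    by_contra hne
    have : Φ.val (f t) * weightPrimitive u t ≤ 1 := by
      calc _ ≤ ∫⁻ y in Ioo 0 t, Φ.val (f t) * ENNReal.ofReal (u y) := lintegral_const_mul_le _ _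
        _ ≤ ∫⁻ y in Ioo 0 t, Φ.val (f y) * ENNReal.ofReal (u y) :=
            setLIntegral_mono' measurableSet_Ioo fun y hy => by
              gcongr; exact primitive_mono _ (hf hy.1 ht hy.2.le)
        _ ≤ _ := (lintegral_mono_set Ioo_subset_Ioi_self).trans hΦ
    rw [hu.weightPrimitive_eq_top hx ht, ENNReal.mul_top hne] at this
    exact absurd this (by simp)
  rw [setLIntegral_congr_fun (g := 0) measurableSet_Ioi fun t ht => by simp [hf0 t ht]]
  simp

/-! ### Tonelli for the kernel, gauges, and the conclusion -/

theorem rearrangement_antitone (f : ℝ → ℝ≥0∞) : Antitone (rearrangement f) := fun _ _ hst =>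
  sInf_le_sInf fun _ hl => le_trans hl (ENNReal.ofReal_le_ofReal hst)

theorem MPlus₂.aemeasurable_prod {K : ℝ → ℝ → ℝ≥0∞} (hK : MPlus₂ K) :
    AEMeasurable (Function.uncurry K)
      ((volume.restrict (Ioi (0 : ℝ))).prod (volume.restrict (Ioi (0 : ℝ)))) := by
  rw [Measure.prod_restrict]; exact hK

/-- Almost every section of an a.e. measurable function on a product is a.e. measurable. -/
theorem ae_aemeasurable_section {α β γ : Type*} [MeasurableSpace α] [MeasurableSpace β]
    [MeasurableSpace γ] {μ : Measure α} {ν : Measure β} [SFinite ν] {F : α × β → γ}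
    (hF : AEMeasurable F (μ.prod ν)) : ∀ᵐ x ∂μ, AEMeasurable (fun y => F (x, y)) ν := by
  filter_upwards [Measure.ae_ae_of_ae_prod hF.ae_eq_mk] with x hx
  exact ⟨fun y => hF.mk F (x, y), hF.measurable_mk.comp measurable_prodMk_left, hx⟩

theorem lintegral_opT_mul {K : ℝ → ℝ → ℝ≥0∞} (hK : MPlus₂ K) {f g : ℝ → ℝ≥0∞} (hf : MPlus f)
    (hg : MPlus g) :
    ∫⁻ x in Ioi (0 : ℝ), opT K f x * g x = ∫⁻ y in Ioi (0 : ℝ), f y * opT' K g y := by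
  have hK' := hK.aemeasurable_prod
  have hKx : ∀ᵐ x ∂volume.restrict (Ioi (0 : ℝ)),
      AEMeasurable (K x) (volume.restrict (Ioi (0 : ℝ))) := ae_aemeasurable_section hK'
  have hKy : ∀ᵐ y ∂volume.restrict (Ioi (0 : ℝ)),
      AEMeasurable (fun x => K x y) (volume.restrict (Ioi (0 : ℝ))) :=
    ae_aemeasurable_section hK'.prod_swap
  calc _ = ∫⁻ x in Ioi (0 : ℝ), ∫⁻ y in Ioi (0 : ℝ), K x y * f y * g x := by
        refine lintegral_congr_ae ?_
        filter_upwards [hKx] with x hx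
        have hm : AEMeasurable (fun y => K x y * f y) (volume.restrict (Ioi (0 : ℝ))) := hx.mul hf
        rw [lintegral_mul_const'' _ hm, opT]
    _ = ∫⁻ y in Ioi (0 : ℝ), ∫⁻ x in Ioi (0 : ℝ), K x y * f y * g x :=
        lintegral_lintegral_swap ((hK'.mul (AEMeasurable.comp_snd hf)).mul
          (AEMeasurable.comp_fst hg))
    _ = _ := by
        refine lintegral_congr_ae ?_
        filter_upwards [hKy] with y hy
        have hm : AEMeasurable (fun x => K x y * g x) (volume.restrict (Ioi (0 : ℝ))) := hy.mul hg
        rw [opT', ← lintegral_const_mul'' _ hm]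
        refine lintegral_congr fun x => ?_
        ring

theorem MPlus₂.opT {K : ℝ → ℝ → ℝ≥0∞} (hK : MPlus₂ K) {f : ℝ → ℝ≥0∞} (hf : MPlus f) :
    MPlus (opT K f) := by
  have hK' := hK.aemeasurable_prod
  exact (hK'.mul (AEMeasurable.comp_snd hf)).lintegral_prod_right'

theorem MPlus₂.opT' {K : ℝ → ℝ → ℝ≥0∞} (hK : MPlus₂ K) {g : ℝ → ℝ≥0∞} (hg : MPlus g) :
    MPlus (opT' K g) := by
  have hK' := hK.aemeasurable_prod
  exact (hK'.prod_swap.mul (AEMeasurable.comp_snd hg)).lintegral_prod_right'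

theorem modular_le_one_of_gauge_lt {φ : ℝ → ℝ} {u : ℝ → ℝ} {f : ℝ → ℝ≥0∞} {l : ℝ≥0∞}
    (h : gauge (primitive φ) u f < l) :
    ∫⁻ x in Ioi (0 : ℝ), primitive φ (f x / l) * ENNReal.ofReal (u x) ≤ 1 := by
  obtain ⟨l', ⟨_, _, h'⟩, hl⟩ := sInf_lt_iff.1 h
  refine le_trans (lintegral_mono fun x => ?_) h'
  gcongr
  exact primitive_mono _ (ENNReal.div_le_div_left hl.le _)

theorem gauge_le_one {φ : ℝ → ℝ} {u : ℝ → ℝ} {f : ℝ → ℝ≥0∞}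
    (h : ∫⁻ x in Ioi (0 : ℝ), primitive φ (f x) * ENNReal.ofReal (u x) ≤ 1) :
    gauge (primitive φ) u f ≤ 1 :=
  sInf_le ⟨one_pos, ENNReal.one_lt_top, by simpa using h⟩

end OrliczLorentz

end

theorem theorem6 (K : ℝ → ℝ → ℝ≥0∞) (hK : OrliczLorentz.MPlus₂ K)
    (Φ₁ Φ₂ : OrliczLorentz.NFunction) (hΦ₂ : Φ₂.DoublingAtInfinity)
    (u₁ u₂ : ℝ → ℝ) (hu₁ : OrliczLorentz.IsWeight u₁) (hu₂ : OrliczLorentz.IsWeight u₂)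
    (hu₂_top : ∫⁻ x in Ioi (0 : ℝ), ENNReal.ofReal (u₂ x) = ⊤)
    -- If `g > 0` on a set of positive measure where `u₁ = 0`, then `g / u₁ = ∞` there and the
    -- right side below is understood to be `∞`; so only `g` vanishing where `u₁` does matter.
    (hS : ∃ C : ℝ≥0, 0 < C ∧ ∀ g : ℝ → ℝ≥0∞, OrliczLorentz.MPlus g →
      (∀ x, 0 < x → u₁ x = 0 → g x = 0) →
      OrliczLorentz.gauge Φ₂.compl u₂
          (fun x => OrliczLorentz.opS K g x / OrliczLorentz.weightPrimitive u₂ x) ≤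
        C * OrliczLorentz.gauge Φ₁.compl u₁ (fun x => g x / ENNReal.ofReal (u₁ x))) :
    ∃ C : ℝ≥0, 0 < C ∧ ∀ f : ℝ → ℝ≥0∞, OrliczLorentz.MPlus f →
      OrliczLorentz.gauge Φ₁.val u₁
          (OrliczLorentz.opT K (OrliczLorentz.rearrangement f)) ≤
        C * OrliczLorentz.gauge Φ₂.val u₂ (OrliczLorentz.rearrangement f) := by
  obtain ⟨C, -, hS⟩ := hS
  -- The 10 is the pairing constant. Replacing C by C + 1 makes the gauge bound strict, so the
  -- modular at that level is at most 1 even if the infimum is not attained.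
  refine ⟨10 * (C + 1), by positivity, fun f _ => ?_⟩
  set r := OrliczLorentz.rearrangement f
  have hr : Antitone r := OrliczLorentz.rearrangement_antitone f
  have hrm : OrliczLorentz.MPlus r := hr.measurable.aemeasurable
  set A : ℝ≥0∞ := C + 1
  have hA0 : A ≠ 0 := by simp [A]
  have hAtop : A ≠ ⊤ := by simp [A]
  have hcoe : ((10 * (C + 1) : ℝ≥0) : ℝ≥0∞) = 10 * A := by simp [A]
  have hCtop : 10 * A ≠ ⊤ := ENNReal.mul_ne_top ENNReal.ofNat_ne_top hAtop
  have hC0 : 10 * A ≠ 0 := mul_ne_zero (by norm_num) hA0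
  -- Moving the constant to the left reduces the claim to each admissible l in the right-hand
  -- infimum.
  rw [hcoe, mul_comm, ← ENNReal.div_le_iff hC0 hCtop]
  refine le_sInf fun l hl => ?_
  obtain ⟨hl0, hltop, hl⟩ := hl
  rw [ENNReal.div_le_iff hC0 hCtop]
  have hL0 : l * (10 * A) ≠ 0 := mul_ne_zero hl0.ne' hC0
  have hLtop : l * (10 * A) ≠ ⊤ := ENNReal.mul_ne_top hltop.ne hCtop
  refine sInf_le ⟨pos_iff_ne_zero.2 hL0, hLtop.lt_top, ?_⟩
  refine OrliczLorentz.modular_le_one_of_pairing Φ₁ hu₁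
    (AEMeasurable.div_const (hK.opT hrm) _) fun g hg hg0 hg1 => ?_
  have hlt : OrliczLorentz.gauge Φ₂.compl u₂
      (fun x => OrliczLorentz.opS K g x / OrliczLorentz.weightPrimitive u₂ x) < A := by
    refine (hS g hg hg0).trans_lt ?_
    calc (C : ℝ≥0∞) * _ ≤ C * 1 := by gcongr; exact OrliczLorentz.gauge_le_one hg1
      _ < A := by
        rw [mul_one]
        exact ENNReal.lt_add_right ENNReal.coe_ne_top one_ne_zero
  have hΨ := OrliczLorentz.modular_le_one_of_gauge_lt hlt
  have hTg := hK.opT' hg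
  have key := OrliczLorentz.lintegral_antitone_mul_le Φ₂ hu₂ hu₂_top
    (f := fun x => r x / l) (h := fun y => A⁻¹ * OrliczLorentz.opT' K g y)
    (fun x _ y _ hxy => ENNReal.div_le_div_right (hr hxy) _) (hTg.const_mul _) hl ?_
  · have hcalc : ∫⁻ x in Ioi (0 : ℝ), r x / l * (A⁻¹ * OrliczLorentz.opT' K g x) =
        l⁻¹ * A⁻¹ * ∫⁻ x in Ioi (0 : ℝ), OrliczLorentz.opT K r x * g x := by
      rw [OrliczLorentz.lintegral_opT_mul hK hrm hg, ← lintegral_const_mul' _ _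
        (ENNReal.mul_ne_top (ENNReal.inv_ne_top.2 hl0.ne') (ENNReal.inv_ne_top.2 hA0))]
      refine lintegral_congr fun x => ?_
      rw [div_eq_mul_inv]
      ring
    rw [hcalc] at key
    have hinv : (l * (10 * A))⁻¹ = 10⁻¹ * (l⁻¹ * A⁻¹) := by
      rw [ENNReal.mul_inv (Or.inl hl0.ne') (Or.inl hltop.ne),
        ENNReal.mul_inv (Or.inl (by norm_num)) (Or.inl ENNReal.ofNat_ne_top)]
      ring
    calc _ = ∫⁻ x in Ioi (0 : ℝ), (l * (10 * A))⁻¹ * (OrliczLorentz.opT K r x * g x) := by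
          refine lintegral_congr fun x => ?_
          rw [div_eq_mul_inv]
          ring
      _ = 10⁻¹ * (l⁻¹ * A⁻¹ * ∫⁻ x in Ioi (0 : ℝ), OrliczLorentz.opT K r x * g x) := by
          rw [lintegral_const_mul' _ _ (ENNReal.inv_ne_top.2 hL0), hinv, mul_assoc]
      _ ≤ 10⁻¹ * 10 := by gcongr
      _ = 1 := ENNReal.inv_mul_cancel (by norm_num) ENNReal.ofNat_ne_top
  · refine le_trans (le_of_eq (lintegral_congr fun x => ?_)) hΨ
    rw [lintegral_const_mul' _ _ (ENNReal.inv_ne_top.2 hA0)]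
    congr 2
    simp only [OrliczLorentz.opS, div_eq_mul_inv]
    ring
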